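/- For $n\ge 1$ let $|\mathrm{GHZ}_n\rangle=\frac{1}{\sqrt2}(|0\rangle^{\otimes n}+|1\rangle^{\otimes n})\in(\mathbb{C}^2)^{\otimes n}$ and $\mathrm{GHZ}_n=|\mathrm{GHZ}_n\rangle\langle\mathrm{GHZ}_n|$. For $p\in[0,1]$ let $\rho(p)=p\,\phi^++\frac{1-p}{4}\mathbb{1}$ be the two-qubit isotropic state of visibility $p$, where $\phi^+$ is the projector onto $\frac{1}{\sqrt2}(|00\rangle+|11\rangle)$, and let $\mathcal{T}_p(\rho)=\mathcal{T}(\rho\otimes\rho(p))$ be the noisy teleportation channel, where $\mathcal{T}$ is the standard qubit teleportation protocol (Bell measurement on the first two qubits, followed by the corresponding Pauli correction on the third). Thus $(\mathcal{T}_p)^{\otimes n}(\mathrm{GHZ}_n)$ is the $n$-qubit state that arises when the centre of a star network with $n$ isotropic links of visibility $p$ teleports one share of a GHZ state to each of the other $n$ parties. An $n$-qubit state $\rho$, with one qubit held by each of $n$ parties, is called GHZ-distillable if there are $n$-partite LOCC maps $\Lambda_k$ ($k\in\mathbb{N}$), taking $k$ copies of the $n$-qubit system to one $n$-qubit system, such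 that $$\lim_{k\to\infty}F\bigl(\Lambda_k(\rho^{\otimes k}),\mathrm{GHZ}_n\bigr)=1,\qquad F(\rho,\sigma)=\Bigl(\operatorname{tr}\sqrt{\sqrt\rho\,\sigma\sqrt\rho}\Bigr)^2 .$$ Here LOCC maps are the maps implemented by finite-round protocols of local quantum operations and classical communication, together with all limits of such maps. **Theorem.** For every $p\in[0,1)$ there exists $n_0\in\mathbb{N}$ such that for all $n\ge n_0$ the state $(\mathcal{T}_p)^{\otimes n}(\mathrm{GHZ}_n)$ is not GHZ-distillable. -/

import Mathlib

namespace GHZNetwork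

noncomputable section

open scoped Kronecker MatrixOrder ComplexOrder

/-- Operators on the finite-dimensional Hilbert space with canonical basis indexed by `a`. -/
abbrev Op (a : Type) : Type := Matrix a a ℂ

/-- The rank-one operator `|v⟩⟨v|`. -/
def ketbra {a : Type} (v : a → ℂ) : Op a := Matrix.vecMulVec v (star v)

/-- The fidelity `F(ρ, σ) = (tr √(√ρ σ √ρ))²`. -/
def fidelity {a : Type} [Fintype a] [DecidableEq a] (ρ σ : Op a) : ℝ :=
  (Matrix.trace (CFC.sqrt (CFC.sqrt ρ * σ * CFC.sqrt ρ))).re ^ 2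

/-! ### Quantum operations -/

section Operations

variable {a b : Type} [Fintype a]

/-- The linear map `X ↦ ∑ y, K y * X * (K y)†`. -/
def krausMap {κ : Type} [Fintype κ] (K : κ → Matrix b a ℂ) : Op a →ₗ[ℂ] Op b where
  toFun X := ∑ y, K y * X * (K y).conjTranspose
  map_add' X Y := by simp [Matrix.mul_add, Matrix.add_mul, Finset.sum_add_distrib]
  map_smul' c X := by simp [Finset.smul_sum]

/-- Complete positivity, in operator-sum form. -/
def IsCP (Φ : Op a →ₗ[ℂ] Op b) : Prop :=
  ∃ (r : ℕ) (K : Fin r → Matrix b a ℂ), Φ = krausMap K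

/-- Preservation of the trace. -/
def IsTP [Fintype b] (Φ : Op a →ₗ[ℂ] Op b) : Prop :=
  ∀ X, (Φ X).trace = X.trace

end Operations

/-! ### Multipartite systems

The parties are the elements of a finite type `ι`; party `i` holds the space with canonical basis
indexed by `A i`, so that the canonical basis of the global space is indexed by `∀ i, A i`. -/

section LOCC

variable {ι : Type} [Fintype ι] [DecidableEq ι]

/-- The tensor product `⨂ i, Φ i` of linear maps on local operators: the linear map that sends
`⨂ i, |a i⟩⟨a' i|` to `⨂ i, Φ i (|a i⟩⟨a' i|)`. -/
def tensorMap {A B : ι → Type} [∀ i, Fintype (A i)] [∀ i, DecidableEq (A i)]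
    (Φ : ∀ i, Op (A i) →ₗ[ℂ] Op (B i)) : Op (∀ i, A i) →ₗ[ℂ] Op (∀ i, B i) where
  toFun X := Matrix.of fun b b' =>
    ∑ a, ∑ a', X a a' * ∏ i, Φ i (Matrix.single (a i) (a' i) 1) (b i) (b' i)
  map_add' X Y := by
    ext b b'
    simp [add_mul, Finset.sum_add_distrib]
  map_smul' c X := by
    ext b b'
    simp [Finset.mul_sum, mul_assoc]

/-- Maps that are implemented by an LOCC protocol with finitely many rounds. Either every party
applies a local channel and the protocol ends, or one party `j` applies a local instrument and
broadcasts the outcome `x`, every other party applies a local channel that may depend on `x`, and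
the parties go on with an LOCC protocol that may depend on `x`. The local dimensions are
arbitrary at every stage. -/
inductive IsFiniteLOCC {B : ι → Type} [∀ i, Fintype (B i)] [∀ i, DecidableEq (B i)] :
    ∀ (A : ι → Type) [∀ i, Fintype (A i)] [∀ i, DecidableEq (A i)],
      (Op (∀ i, A i) →ₗ[ℂ] Op (∀ i, B i)) → Prop
  | localChannels (A : ι → Type) [∀ i, Fintype (A i)] [∀ i, DecidableEq (A i)]
      (Φ : ∀ i, Op (A i) →ₗ[ℂ] Op (B i))
      (cp : ∀ i, IsCP (Φ i)) (tp : ∀ i, IsTP (Φ i)) :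
      IsFiniteLOCC A (tensorMap Φ)
  | round (A : ι → Type) [∀ i, Fintype (A i)] [∀ i, DecidableEq (A i)]
      (j : ι) (m : ℕ) (C : Fin m → ι → Type)
      [∀ x i, Fintype (C x i)] [∀ x i, DecidableEq (C x i)]
      (Φ : ∀ x i, Op (A i) →ₗ[ℂ] Op (C x i))
      (cp : ∀ x i, IsCP (Φ x i))
      (tp : ∀ x i, i ≠ j → IsTP (Φ x i))
      (instr : ∀ X, ∑ x, (Φ x j X).trace = X.trace)
      (Λ : ∀ x, Op (∀ i, C x i) →ₗ[ℂ] Op (∀ i, B i))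
      (next : ∀ x, IsFiniteLOCC (C x) (Λ x)) :
      IsFiniteLOCC A (∑ x, Λ x ∘ₗ tensorMap (Φ x))

/-- LOCC maps, in the widest sense: limits of maps implemented by finite-round LOCC protocols.
This includes the finite-round maps and those of protocols with infinitely many rounds. -/
def IsLOCC {A B : ι → Type} [∀ i, Fintype (A i)] [∀ i, DecidableEq (A i)]
    [∀ i, Fintype (B i)] [∀ i, DecidableEq (B i)]
    (Λ : Op (∀ i, A i) →ₗ[ℂ] Op (∀ i, B i)) : Prop :=
  ∃ Λs : ℕ → (Op (∀ i, A i) →ₗ[ℂ] Op (∀ i, B i)),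
    (∀ r, IsFiniteLOCC A (Λs r)) ∧
      ∀ X, Filter.Tendsto (fun r => Λs r X) Filter.atTop (nhds (Λ X))

/-- `ρ^{⊗ k}` as a state of the same parties: party `i` holds the `i`-th share of each of the `k`
copies, that is, the space with canonical basis indexed by `Fin k → A i`. -/
def copies {A : ι → Type} (k : ℕ) (ρ : Op (∀ i, A i)) : Op (∀ i, Fin k → A i) :=
  Matrix.of fun s t => ∏ c, ρ (fun i => s i c) (fun i => t i c)

end LOCC

/-! ### GHZ states and their distillation -/

/-- The vector `(|0⟩^{⊗ n} + |1⟩^{⊗ n}) / √2`. -/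
def ghzVec (n : ℕ) : (Fin n → Fin 2) → ℂ := fun s =>
  ((1 / √2 : ℝ) : ℂ) * ((if s = fun _ => 0 then 1 else 0) + (if s = fun _ => 1 then 1 else 0))

/-- The `n`-qubit GHZ state. -/
def ghz (n : ℕ) : Op (Fin n → Fin 2) := ketbra (ghzVec n)

/-- An `n`-qubit state `ρ` is GHZ-distillable if there are LOCC maps `Λ k` from `k` copies to
`n` qubits, one held by each party, with `F(Λ k (ρ^{⊗ k}), GHZ) → 1` as `k → ∞`. -/
def GHZDistillable (n : ℕ) (ρ : Op (Fin n → Fin 2)) : Prop :=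
  ∃ Λ : ∀ k : ℕ, Op (Fin n → Fin k → Fin 2) →ₗ[ℂ] Op (Fin n → Fin 2),
    (∀ k, IsLOCC (A := fun _ : Fin n => Fin k → Fin 2) (B := fun _ : Fin n => Fin 2) (Λ k)) ∧
      Filter.Tendsto
        (fun k => fidelity (Λ k (copies (A := fun _ : Fin n => Fin 2) k ρ)) (ghz n))
        Filter.atTop (nhds 1)

/-! ### Noisy teleportation of qubits -/

/-- The two-qubit maximally entangled vector `|φ⁺⟩ = (|00⟩ + |11⟩) / √2`. -/
def phiPlus : Fin 2 × Fin 2 → ℂ := fun s => if s.1 = s.2 then ((1 / √2 : ℝ) : ℂ) else 0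

/-- The two-qubit isotropic state `p φ⁺ + (1 - p) 𝟙 / 4` of visibility `p`. -/
def isotropic (p : ℝ) : Op (Fin 2 × Fin 2) :=
  (p : ℂ) • ketbra phiPlus + (((1 - p) / 4 : ℝ) : ℂ) • 1

/-- The Pauli operators `X ^ u * Z ^ v`. -/
def pauli (u v : Fin 2) : Op (Fin 2) :=
  !![0, 1; 1, 0] ^ (u : ℕ) * !![1, 0; 0, -1] ^ (v : ℕ)

/-- The Bell basis `(X ^ u * Z ^ v ⊗ 𝟙) |φ⁺⟩`. -/
def bell (u v : Fin 2) : Fin 2 × Fin 2 → ℂ :=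
  (pauli u v ⊗ₖ (1 : Op (Fin 2))).mulVec phiPlus

/-- The standard teleportation protocol from qubit 1 to qubit 3: qubits 1 and 2 are measured in
the Bell basis and, on outcome `(u, v)`, the correction `X ^ u * Z ^ v` is applied to qubit 3. The
Kraus operator for this outcome is `⟨bell u v|₁₂ ⊗ X ^ u * Z ^ v`. -/
def teleport : Op (Fin 2 × (Fin 2 × Fin 2)) →ₗ[ℂ] Op (Fin 2) :=
  krausMap fun o : Fin 2 × Fin 2 =>
    Matrix.of fun k (s : Fin 2 × (Fin 2 × Fin 2)) =>
      star (bell o.1 o.2 (s.1, s.2.1)) * pauli o.1 o.2 k s.2.2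

/-- The noisy teleportation channel `ρ ↦ teleport (ρ ⊗ isotropic p)`. -/
def noisyTeleport (p : ℝ) : Op (Fin 2) →ₗ[ℂ] Op (Fin 2) where
  toFun ρ := teleport (ρ ⊗ₖ isotropic p)
  map_add' ρ σ := by simp [Matrix.add_kronecker]
  map_smul' c ρ := by simp [Matrix.smul_kronecker]

/-- The state of `n` parties after the centre of a star network, whose links are isotropic states
of visibility `p`, has teleported one share of a GHZ state to each of them. -/
def teleportedGHZ (p : ℝ) (n : ℕ) : Op (Fin n → Fin 2) :=
  tensorMap (fun _ : Fin n => noisyTeleport p) (ghz n)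

end

end GHZNetwork

/-! Transposing the shares of a set `S` of parties turns a local operation of a party in `S` into
the conjugate of that operation by the transposition, which is again completely positive. Hence
LOCC maps preserve positivity of the partial transpose. A PPT state `X` of `n` qubits has
GHZ fidelity at most `1 / 2`: at the two strings that are constant on `S` and on its complement but
not constant, the partial transpose of `X` has the coherence `⟨0…0|X|1…1⟩` off the diagonal, so the
real part of the coherence is at most the mean of two populations of `X` other than those of `0…0`
and `1…1`, and the fidelity is at most half the trace.

Noisy teleportation is the depolarizing channel `X ↦ p X + (1 - p) tr(X) 𝟙 / 2`, so the teleported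
GHZ state has coherence `pⁿ / 2`, whereas with `S` a single party the two populations that have to
dominate it are at least `(1 - p) / 2 · ((1 + p) / 2)ⁿ⁻¹ / 2`. Since `p < (1 + p) / 2`, they do for
large `n`. -/

namespace GHZNetwork

open Filter

open scoped Kronecker MatrixOrder ComplexOrder

lemma isClosed_setOf_posSemidef {a : Type} [Finite a] : IsClosed {X : Op a | X.PosSemidef} := by
  classical
  have := Fintype.ofFinite a
  open scoped Matrix.Norms.L2Operator in
  simpa only [Matrix.nonneg_iff_posSemidef] using CStarAlgebra.isClosed_nonneg (A := Op a)

lemma re_add_re_le_of_posSemidef {a : Type} [Finite a] {X : Op a} (hX : X.PosSemidef) (i j : a) :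
    (X i j).re + (X j i).re ≤ (X i i).re + (X j j).re := by
  classical
  have := Fintype.ofFinite a
  have h := (Complex.le_def.mp
    (hX.dotProduct_mulVec_nonneg (Pi.single i 1 - Pi.single j 1))).1
  simp only [star_sub, Pi.star_single, star_one, Matrix.mulVec_sub, Matrix.mulVec_single_one,
    dotProduct_sub, sub_dotProduct, single_dotProduct, Matrix.col_apply, one_mul, Complex.sub_re,
    Complex.zero_re] at h
  linarith

lemma posSemidef_abs_smul_add_smul_single {a : Type} [Finite a] [DecidableEq a] (s t : a)
    (c : ℝ) :
    (((|c| : ℝ) : ℂ) • (Matrix.single s s (1 : ℂ) + Matrix.single t t 1) +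
      (c : ℂ) • (Matrix.single s t 1 + Matrix.single t s 1)).PosSemidef := by
  set ε : ℝ := (SignType.sign c : ℝ)
  have hεc : ((ε * |c| : ℝ) : ℂ) = c := by rw [sign_mul_abs]
  have hεε : ((ε * (ε * |c|) : ℝ) : ℂ) = (|c| : ℝ) := by rw [sign_mul_abs, sign_mul_self]
  push_cast at hεc hεε
  let v : a → ℂ := Pi.single s 1 + (ε : ℂ) • Pi.single t 1
  convert (Matrix.posSemidef_vecMulVec_self_star v).smul (Complex.zero_le_real.mpr (abs_nonneg c))
    using 1
  simp only [v, star_add, star_smul, Complex.star_def, Complex.conj_ofReal, Pi.star_single,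
    map_one, Matrix.vecMulVec_add, Matrix.add_vecMulVec, Matrix.vecMulVec_smul,
    Matrix.smul_vecMulVec, ← Matrix.single_eq_single_vecMulVec_single]
  linear_combination (norm := module) -hεc • (Matrix.single s t (1 : ℂ) + Matrix.single t s 1) -
    hεε • Matrix.single t t (1 : ℂ)

lemma posSemidef_diagonal_add_single {a : Type} [Finite a] [DecidableEq a] {d : a → ℝ}
    (hd : ∀ i, 0 ≤ d i) {s t : a} (hst : s ≠ t) {c : ℝ} (hs : |c| ≤ d s) (ht : |c| ≤ d t) :
    (Matrix.diagonal (fun i => (d i : ℂ)) +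
      (c : ℂ) • (Matrix.single s t 1 + Matrix.single t s 1)).PosSemidef := by
  have hrest : (Matrix.diagonal fun i =>
      ((d i - if i = s ∨ i = t then |c| else 0 : ℝ) : ℂ)).PosSemidef :=
    .diagonal fun i => Complex.zero_le_real.mpr (by grind)
  convert hrest.add (posSemidef_abs_smul_add_smul_single s t c) using 1
  rw [← add_assoc]
  congr 1
  ext i j
  simp only [Matrix.add_apply, Matrix.smul_apply, smul_eq_mul, Matrix.diagonal_apply,
    Matrix.single_apply, Complex.ofReal_sub, apply_ite Complex.ofReal, Complex.ofReal_zero]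
  grind

lemma linearMap_ext_single {a : Type} [Finite a] [DecidableEq a] {M : Type*} [AddCommMonoid M]
    [Module ℂ M] {f g : Op a →ₗ[ℂ] M}
    (h : ∀ s t, f (Matrix.single s t 1) = g (Matrix.single s t 1)) : f = g :=
  Matrix.ext_linearMap _ fun s t => LinearMap.ext_ring (h s t)

section Kraus

variable {a b : Type} [Fintype a]

lemma krausMap_single {κ : Type} [Fintype κ] [DecidableEq a] (K : κ → Matrix b a ℂ) (s t : a)
    (x y : b) : krausMap K (Matrix.single s t 1) x y = ∑ k, K k x s * star (K k y t) := by
  simp [krausMap, Matrix.sum_apply, Matrix.mul_apply, Matrix.single_apply, ite_and]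

lemma isCP_krausMap {κ : Type} [Fintype κ] (K : κ → Matrix b a ℂ) : IsCP (krausMap K) := by
  refine ⟨Fintype.card κ, K ∘ (Fintype.equivFin κ).symm, LinearMap.ext fun X => ?_⟩
  exact ((Fintype.equivFin κ).symm.sum_comp fun k => K k * X * (K k).conjTranspose).symm

lemma IsCP.posSemidef [Finite b] {Φ : Op a →ₗ[ℂ] Op b} (hΦ : IsCP Φ) {X : Op a}
    (hX : X.PosSemidef) : (Φ X).PosSemidef := by
  have := Fintype.ofFinite b
  obtain ⟨r, K, rfl⟩ := hΦ
  exact Matrix.posSemidef_sum _ fun k _ => hX.mul_mul_conjTranspose_same (K k)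

end Kraus

/-- The conjugate `X ↦ (Φ Xᵀ)ᵀ` of a map on operators by the transposition. -/
def transposeMap {a b : Type} (Φ : Op a →ₗ[ℂ] Op b) : Op a →ₗ[ℂ] Op b :=
  (Matrix.transposeLinearEquiv b b ℂ ℂ).toLinearMap ∘ₗ Φ ∘ₗ
    (Matrix.transposeLinearEquiv a a ℂ ℂ).toLinearMap

lemma transposeMap_apply {a b : Type} (Φ : Op a →ₗ[ℂ] Op b) (X : Op a) :
    transposeMap Φ X = (Φ X.transpose).transpose := rfl

lemma IsCP.transposeMap {a b : Type} [Fintype a] {Φ : Op a →ₗ[ℂ] Op b} (hΦ : IsCP Φ) :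
    IsCP (transposeMap Φ) := by
  obtain ⟨r, K, rfl⟩ := hΦ
  refine ⟨r, fun y => (K y).map star, LinearMap.ext fun X => ?_⟩
  rw [transposeMap_apply]
  simp only [krausMap, LinearMap.coe_mk, AddHom.coe_mk, Matrix.transpose_sum,
    Matrix.transpose_mul, Matrix.transpose_transpose, Matrix.mul_assoc]
  exact Finset.sum_congr rfl fun y _ => by
    congr 2
    ext s t
    simp

section Tensor

variable {ι : Type} [Fintype ι] [DecidableEq ι] {A B : ι → Type} [∀ i, Fintype (A i)]
  [∀ i, DecidableEq (A i)]

lemma tensorMap_single (Φ : ∀ i, Op (A i) →ₗ[ℂ] Op (B i)) (a a' : ∀ i, A i) (b b' : ∀ i, B i) :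
    tensorMap Φ (Matrix.single a a' 1) b b' =
      ∏ i, Φ i (Matrix.single (a i) (a' i) 1) (b i) (b' i) := by
  simp [tensorMap, Matrix.single_apply, ite_and]

lemma tensorMap_krausMap {κ : ι → Type} [∀ i, Fintype (κ i)]
    (K : ∀ i, κ i → Matrix (B i) (A i) ℂ) :
    tensorMap (fun i => krausMap (K i)) =
      krausMap fun k : ∀ i, κ i => Matrix.of fun b a => ∏ i, K i (k i) (b i) (a i) := by
  refine linearMap_ext_single fun a a' => ?_
  ext b b'
  simp only [tensorMap_single,
    krausMap_single, Matrix.of_apply, star_prod, ← Finset.prod_mul_distrib, Fintype.prod_sum]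

lemma IsCP.tensorMap {Φ : ∀ i, Op (A i) →ₗ[ℂ] Op (B i)} (hΦ : ∀ i, IsCP (Φ i)) :
    IsCP (tensorMap Φ) := by
  choose r K hK using hΦ
  rw [funext hK, tensorMap_krausMap]
  exact isCP_krausMap _

lemma trace_tensorMap_single [∀ i, Fintype (B i)] (Φ : ∀ i, Op (A i) →ₗ[ℂ] Op (B i))
    (a a' : ∀ i, A i) :
    (tensorMap Φ (Matrix.single a a' 1)).trace =
      ∏ i, (Φ i (Matrix.single (a i) (a' i) 1)).trace := by
  simp only [Matrix.trace, Matrix.diag, tensorMap_single, Fintype.prod_sum]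

lemma trace_single_pi (a a' : ∀ i, A i) :
    (Matrix.single a a' (1 : ℂ)).trace = ∏ i, (Matrix.single (a i) (a' i) (1 : ℂ)).trace := by
  rcases eq_or_ne a a' with rfl | h
  · simp
  · obtain ⟨i, hi⟩ := Function.ne_iff.mp h
    rw [Matrix.trace_single_eq_of_ne _ _ _ h,
      Finset.prod_eq_zero (Finset.mem_univ i) (Matrix.trace_single_eq_of_ne _ _ _ hi)]

lemma sum_trace_tensorMap (j : ι) {κ : Type} [Fintype κ] {C : κ → ι → Type}
    [∀ x i, Fintype (C x i)] {Φ : ∀ x i, Op (A i) →ₗ[ℂ] Op (C x i)}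
    (tp : ∀ x i, i ≠ j → IsTP (Φ x i)) (instr : ∀ X, ∑ x, (Φ x j X).trace = X.trace)
    (X : Op (∀ i, A i)) : ∑ x, (tensorMap (Φ x) X).trace = X.trace := by
  suffices h : ∑ x, Matrix.traceLinearMap _ ℂ ℂ ∘ₗ tensorMap (Φ x) = Matrix.traceLinearMap _ ℂ ℂ by
    simpa using LinearMap.congr_fun h X
  refine linearMap_ext_single fun a a' => ?_
  have htp (x : κ) : ∏ i ∈ Finset.univ.erase j, (Φ x i (Matrix.single (a i) (a' i) 1)).trace =
      ∏ i ∈ Finset.univ.erase j, (Matrix.single (a i) (a' i) (1 : ℂ)).trace :=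
    Finset.prod_congr rfl fun i hi => tp x i (Finset.ne_of_mem_erase hi) _
  simp only [LinearMap.sum_apply, LinearMap.comp_apply, Matrix.traceLinearMap_apply,
    trace_tensorMap_single, trace_single_pi, ← Finset.mul_prod_erase _ _ (Finset.mem_univ j), htp,
    ← Finset.sum_mul, instr]

lemma isTP_tensorMap [∀ i, Fintype (B i)] {Φ : ∀ i, Op (A i) →ₗ[ℂ] Op (B i)}
    (tp : ∀ i, IsTP (Φ i)) : IsTP (tensorMap Φ) := by
  intro X
  suffices h : Matrix.traceLinearMap _ ℂ ℂ ∘ₗ tensorMap Φ = Matrix.traceLinearMap _ ℂ ℂ from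
    LinearMap.congr_fun h X
  refine linearMap_ext_single fun a a' => ?_
  simp only [LinearMap.comp_apply, Matrix.traceLinearMap_apply,
    trace_tensorMap_single, trace_single_pi, tp _ _]

end Tensor

section PartialTranspose

variable {ι : Type} [DecidableEq ι] {A : ι → Type} (S : Finset ι)

/-- The partial transpose with respect to the set `S` of parties, which exchanges the entries of
these parties between the row and the column index. -/
def partialTranspose : Op (∀ i, A i) →ₗ[ℂ] Op (∀ i, A i) where
  toFun X := Matrix.of fun s t => X (S.piecewise t s) (S.piecewise s t)
  map_add' _ _ := rfl
  map_smul' _ _ := rfl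

lemma partialTranspose_apply (X : Op (∀ i, A i)) (s t : ∀ i, A i) :
    partialTranspose S X s t = X (S.piecewise t s) (S.piecewise s t) := rfl

lemma partialTranspose_empty (X : Op (∀ i, A i)) : partialTranspose ∅ X = X := by
  ext s t
  simp [partialTranspose_apply]

lemma partialTranspose_single [DecidableEq (∀ i, A i)] (s t : ∀ i, A i) :
    partialTranspose S (Matrix.single s t 1) =
      Matrix.single (S.piecewise t s) (S.piecewise s t) 1 := by
  ext x y
  have h : s = S.piecewise y x ∧ t = S.piecewise x y ↔
      S.piecewise t s = x ∧ S.piecewise s t = y := by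
    simp only [funext_iff, Finset.piecewise, ← forall_and]
    exact forall_congr' fun i => by grind
  simp only [partialTranspose_apply, Matrix.single_apply, h]

lemma partialTranspose_diagonal [DecidableEq (∀ i, A i)] (d : (∀ i, A i) → ℂ) :
    partialTranspose S (Matrix.diagonal d) = Matrix.diagonal d := by
  ext s t
  have h : S.piecewise t s = S.piecewise s t ↔ s = t := by
    simp only [funext_iff, Finset.piecewise]
    exact forall_congr' fun i => by grind
  simp only [partialTranspose_apply, Matrix.diagonal_apply, h]
  split_ifs with hst
  · subst hst
    rw [Finset.piecewise_same]
  · rfl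

lemma partialTranspose_copies (k : ℕ) (X : Op (∀ i, A i)) :
    partialTranspose S (copies k X) = copies k (partialTranspose S X) := by
  ext s t
  simp only [partialTranspose_apply, copies, Matrix.of_apply]
  refine Finset.prod_congr rfl fun c _ => ?_
  congr 1 <;> ext i <;> by_cases hi : i ∈ S <;> simp [hi]

lemma partialTranspose_tensorMap [Fintype ι] {B : ι → Type} [∀ i, Fintype (A i)]
    [∀ i, DecidableEq (A i)] (Φ : ∀ i, Op (A i) →ₗ[ℂ] Op (B i)) (X : Op (∀ i, A i)) :
    partialTranspose S (tensorMap Φ X) =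
      tensorMap (fun i => if i ∈ S then transposeMap (Φ i) else Φ i) (partialTranspose S X) := by
  suffices h : partialTranspose S ∘ₗ tensorMap Φ =
      tensorMap (fun i => if i ∈ S then transposeMap (Φ i) else Φ i) ∘ₗ partialTranspose S from
    LinearMap.congr_fun h X
  refine linearMap_ext_single fun a a' => ?_
  ext b b'
  simp only [LinearMap.comp_apply, partialTranspose_single, partialTranspose_apply,
    tensorMap_single]
  refine Finset.prod_congr rfl fun i _ => ?_
  by_cases hi : i ∈ S <;> simp [hi, transposeMap_apply, Matrix.transpose_single]

end PartialTranspose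

section Copies

variable {ι : Type} {A : ι → Type} (k : ℕ)

lemma copies_mul [Fintype ι] [DecidableEq ι] [∀ i, Fintype (A i)] (X Y : Op (∀ i, A i)) :
    copies k (X * Y) = copies k X * copies k Y := by
  ext s t
  simp only [copies, Matrix.of_apply, Matrix.mul_apply, Fintype.prod_sum, Finset.prod_mul_distrib]
  exact (Equiv.piComm fun (_ : Fin k) i => A i).sum_comp fun u =>
    (∏ c, X (s · c) (u · c)) * ∏ c, Y (u · c) (t · c)

lemma trace_copies [Fintype ι] [DecidableEq ι] [∀ i, Fintype (A i)] (X : Op (∀ i, A i)) :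
    (copies k X).trace = X.trace ^ k := by
  simp only [Matrix.trace, Matrix.diag, copies, Matrix.of_apply, ← Fin.prod_const,
    Fintype.prod_sum]
  exact ((Equiv.piComm fun (_ : Fin k) i => A i).sum_comp fun u =>
    ∏ c, X (u · c) (u · c)).symm

lemma posSemidef_copies [Finite ι] [∀ i, Finite (A i)] {X : Op (∀ i, A i)} (hX : X.PosSemidef) :
    (copies k X).PosSemidef := by
  classical
  have := Fintype.ofFinite ι
  have (i : ι) := Fintype.ofFinite (A i)
  obtain ⟨Y, rfl⟩ := CStarAlgebra.nonneg_iff_eq_star_mul_self.mp hX.nonneg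
  have hstar : copies k (star Y) = (copies k Y).conjTranspose := by
    ext s t
    simp [copies, Matrix.star_apply]
  rw [copies_mul, hstar]
  exact Matrix.posSemidef_conjTranspose_mul_self _

end Copies

section LOCC

variable {ι : Type} [Fintype ι] [DecidableEq ι] {A B : ι → Type} [∀ i, Fintype (A i)]
  [∀ i, DecidableEq (A i)]

lemma posSemidef_partialTranspose_tensorMap [∀ i, Finite (B i)] (S : Finset ι)
    {Φ : ∀ i, Op (A i) →ₗ[ℂ] Op (B i)} (hΦ : ∀ i, IsCP (Φ i)) {X : Op (∀ i, A i)}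
    (hX : (partialTranspose S X).PosSemidef) :
    (partialTranspose S (tensorMap Φ X)).PosSemidef := by
  rw [partialTranspose_tensorMap]
  refine (IsCP.tensorMap fun i => ?_).posSemidef hX
  split_ifs
  exacts [(hΦ i).transposeMap, hΦ i]

variable [∀ i, Fintype (B i)] [∀ i, DecidableEq (B i)] {Λ : Op (∀ i, A i) →ₗ[ℂ] Op (∀ i, B i)}

lemma IsFiniteLOCC.isTP (hΛ : IsFiniteLOCC A Λ) : IsTP Λ := by
  induction hΛ with
  | localChannels _ _ _ tp => exact isTP_tensorMap tp
  | round _ j _ _ _ _ tp instr _ _ ih =>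
    intro X
    simp only [LinearMap.sum_apply, LinearMap.comp_apply, Matrix.trace_sum, ih _ _,
      sum_trace_tensorMap j tp instr]

lemma IsFiniteLOCC.posSemidef_partialTranspose (hΛ : IsFiniteLOCC A Λ) {S : Finset ι}
    {X : Op (∀ i, A i)} (hX : (partialTranspose S X).PosSemidef) :
    (partialTranspose S (Λ X)).PosSemidef := by
  induction hΛ with
  | localChannels _ _ cp _ => exact posSemidef_partialTranspose_tensorMap S cp hX
  | round _ _ _ _ _ cp _ _ _ _ ih =>
    rw [LinearMap.sum_apply, map_sum]
    exact Matrix.posSemidef_sum _ fun x _ =>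
      ih x (posSemidef_partialTranspose_tensorMap S (cp x) hX)

lemma IsLOCC.isTP (hΛ : IsLOCC Λ) : IsTP Λ := by
  obtain ⟨Λs, hΛs, hlim⟩ := hΛ
  intro X
  have htrace := ((continuous_id.matrix_trace (R := ℂ)).tendsto _).comp (hlim X)
  refine tendsto_nhds_unique htrace ?_
  simp [Function.comp_def, (hΛs _).isTP X]

lemma IsLOCC.posSemidef_partialTranspose (hΛ : IsLOCC Λ) {S : Finset ι} {X : Op (∀ i, A i)}
    (hX : (partialTranspose S X).PosSemidef) : (partialTranspose S (Λ X)).PosSemidef := by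
  obtain ⟨Λs, hΛs, hlim⟩ := hΛ
  have hcont : Continuous (partialTranspose (A := B) S) :=
    (partialTranspose S).continuous_of_finiteDimensional
  exact isClosed_setOf_posSemidef.mem_of_tendsto ((hcont.tendsto _).comp (hlim X))
    (.of_forall fun r => (hΛs r).posSemidef_partialTranspose hX)

end LOCC

section PPT

variable {ι : Type} [Fintype ι] [DecidableEq ι] {A B : ι → Type} [∀ i, Fintype (A i)]
  [∀ i, Fintype (B i)] {S : Finset ι} {X : Op (∀ i, A i)}

/-- Density operators that stay positive under the partial transpose with respect to the set `S`
of parties. LOCC maps preserve this class, which contains every state without entanglement between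
`S` and its complement. -/
structure IsPPTState (S : Finset ι) (X : Op (∀ i, A i)) : Prop where
  posSemidef : X.PosSemidef
  posSemidef_partialTranspose : (partialTranspose S X).PosSemidef
  trace_eq_one : X.trace = 1

lemma IsPPTState.copies (hX : IsPPTState S X) (k : ℕ) : IsPPTState S (copies k X) where
  posSemidef := posSemidef_copies k hX.posSemidef
  posSemidef_partialTranspose := by
    rw [partialTranspose_copies]
    exact posSemidef_copies k hX.posSemidef_partialTranspose
  trace_eq_one := by rw [trace_copies, hX.trace_eq_one, one_pow]

lemma IsLOCC.isPPTState [∀ i, DecidableEq (A i)] [∀ i, DecidableEq (B i)]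
    {Λ : Op (∀ i, A i) →ₗ[ℂ] Op (∀ i, B i)} (hΛ : IsLOCC Λ) (hX : IsPPTState S X) :
    IsPPTState S (Λ X) where
  posSemidef := by
    rw [← partialTranspose_empty (Λ X)]
    exact hΛ.posSemidef_partialTranspose ((partialTranspose_empty X).symm ▸ hX.posSemidef)
  posSemidef_partialTranspose := hΛ.posSemidef_partialTranspose hX.posSemidef_partialTranspose
  trace_eq_one := (hΛ.isTP X).trans hX.trace_eq_one

end PPT

section Fidelity

lemma ketbra_ofReal_smul {a : Type} (r : ℝ) (v : a → ℂ) :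
    ketbra ((r : ℂ) • v) = ((r ^ 2 : ℝ) : ℂ) • ketbra v := by
  simp only [ketbra, star_smul, Complex.star_def, Complex.conj_ofReal, Matrix.smul_vecMulVec,
    Matrix.vecMulVec_smul, smul_smul, sq, Complex.ofReal_mul]

variable {a : Type} [Fintype a]

lemma ketbra_mul_self (v : a → ℂ) : ketbra v * ketbra v = (star v ⬝ᵥ v) • ketbra v := by
  simp [ketbra, Matrix.vecMulVec_mul_vecMulVec]

lemma trace_ketbra (v : a → ℂ) : (ketbra v).trace = star v ⬝ᵥ v := by
  rw [ketbra, Matrix.trace_vecMulVec, dotProduct_comm]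

lemma trace_sqrt_ketbra [DecidableEq a] (v : a → ℂ) :
    (CFC.sqrt (ketbra v)).trace = ((√(star v ⬝ᵥ v).re : ℝ) : ℂ) := by
  set r : ℝ := (star v ⬝ᵥ v).re
  have hr : star v ⬝ᵥ v = r := Complex.eq_re_of_ofReal_le (dotProduct_star_self_nonneg v)
  rcases eq_or_ne v 0 with rfl | hv
  · simp [r, ketbra]
  have hr0 : 0 < r := (Complex.lt_def.mp (Matrix.dotProduct_star_self_pos_iff.mpr hv)).1
  have hsqrt : CFC.sqrt (ketbra v) = (((√r)⁻¹ : ℝ) : ℂ) • ketbra v := by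
    refine CFC.sqrt_unique ?_ (Matrix.nonneg_iff_posSemidef.mpr ?_)
    · rw [smul_mul_smul_comm, ketbra_mul_self, smul_smul, hr, ← Complex.ofReal_mul,
        ← Complex.ofReal_mul, ← mul_inv, Real.mul_self_sqrt hr0.le, inv_mul_cancel₀ hr0.ne',
        Complex.ofReal_one, one_smul]
    · exact (Matrix.posSemidef_vecMulVec_self_star v).smul
        (Complex.zero_le_real.mpr (inv_nonneg.mpr (Real.sqrt_nonneg r)))
  rw [hsqrt, Matrix.trace_smul, trace_ketbra, hr, smul_eq_mul, ← Complex.ofReal_mul,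
    inv_mul_eq_div, Real.div_sqrt]

lemma fidelity_ketbra [DecidableEq a] {X : Op a} (hX : X.PosSemidef) (v : a → ℂ) :
    fidelity X (ketbra v) = (X * ketbra v).trace.re := by
  set R : Op a := CFC.sqrt X
  have hR : R.conjTranspose = R :=
    (Matrix.nonneg_iff_posSemidef.mp (CFC.sqrt_nonneg X)).isHermitian
  have hRR : R * R = X := CFC.sqrt_mul_sqrt_self X hX.nonneg
  have hketbra : R * ketbra v * R = ketbra (R.mulVec v) := by
    rw [ketbra, Matrix.mul_vecMulVec, Matrix.vecMulVec_mul, ketbra, Matrix.star_mulVec, hR]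
  have htrace : star (R.mulVec v) ⬝ᵥ R.mulVec v = (X * ketbra v).trace := by
    rw [← trace_ketbra, ← hketbra, Matrix.trace_mul_cycle, hRR]
  have hnonneg : 0 ≤ (X * ketbra v).trace.re :=
    htrace ▸ (Complex.le_def.mp (dotProduct_star_self_nonneg _)).1
  rw [fidelity, hketbra, trace_sqrt_ketbra, htrace, Complex.ofReal_re, Real.sq_sqrt hnonneg]

end Fidelity

section GHZ

variable {n : ℕ}

lemma ghz_eq (n : ℕ) :
    ghz n = (1 / 2 : ℂ) • (Matrix.single 0 0 1 + Matrix.single 1 1 1 +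
      (Matrix.single 0 1 1 + Matrix.single 1 0 1)) := by
  have hvec : ghzVec n = ((1 / √2 : ℝ) : ℂ) • (Pi.single 0 1 + Pi.single 1 1) := by
    ext s
    simp [ghzVec, Pi.single_apply, Pi.zero_def, Pi.one_def]
  rw [ghz, hvec, ketbra_ofReal_smul, div_pow, Real.sq_sqrt zero_le_two]
  simp only [ketbra, star_add, Pi.star_single, star_one, Matrix.vecMulVec_add,
    Matrix.add_vecMulVec, ← Matrix.single_eq_single_vecMulVec_single]
  push_cast
  module

lemma fidelity_ghz {X : Op (Fin n → Fin 2)} (hX : X.PosSemidef) :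
    fidelity X (ghz n) = ((X 0 0).re + (X 1 1).re + ((X 0 1).re + (X 1 0).re)) / 2 := by
  have hhalf : (1 / 2 : ℂ) = (1 / 2 : ℝ) := by norm_num
  rw [ghz, fidelity_ketbra hX, ← ghz, ghz_eq, hhalf]
  simp only [Matrix.mul_smul, Matrix.mul_add, Matrix.trace_smul, Matrix.trace_add,
    Matrix.trace_mul_single, MulOpposite.op_one, one_smul, smul_eq_mul, Complex.re_ofReal_mul,
    Complex.add_re]
  ring

lemma sum_re_diag_comp_le_re_trace {a κ : Type} [Fintype a] [Fintype κ] {X : Op a}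
    (hX : X.PosSemidef) {f : κ → a} (hf : Function.Injective f) :
    ∑ k, (X (f k) (f k)).re ≤ X.trace.re := by
  classical
  rw [Matrix.trace, Complex.re_sum,
    ← Finset.sum_image (f := fun i => (X i i).re) (hf.injOn (s := _))]
  exact Finset.sum_le_sum_of_subset_of_nonneg (Finset.subset_univ _)
    fun i _ _ => (Complex.le_def.mp hX.diag_nonneg).1

lemma piecewise_const_injective {ι α : Type} [DecidableEq ι] {S : Finset ι} {i j : ι} (hi : i ∈ S)
    (hj : j ∉ S) :
    Function.Injective fun x : α × α =>
      S.piecewise (Function.const ι x.1) (Function.const ι x.2) := by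
  intro x y h
  exact Prod.ext (by simpa [hi] using congrFun h i) (by simpa [hj] using congrFun h j)

lemma IsPPTState.fidelity_ghz_le {S : Finset (Fin n)} {i j : Fin n} (hi : i ∈ S) (hj : j ∉ S)
    {X : Op (Fin n → Fin 2)} (hX : IsPPTState S X) : fidelity X (ghz n) ≤ 1 / 2 := by
  have hoff : (X 0 1).re + (X 1 0).re ≤
      (X (S.piecewise 1 0) (S.piecewise 1 0)).re + (X (S.piecewise 0 1) (S.piecewise 0 1)).re := by
    simpa only [partialTranspose_apply, Finset.piecewise_idem_left, Finset.piecewise_idem_right,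
      Finset.piecewise_same] using
      re_add_re_le_of_posSemidef hX.posSemidef_partialTranspose (S.piecewise 1 0) (S.piecewise 0 1)
  have hdiag : (X 0 0).re + (X (S.piecewise 0 1) (S.piecewise 0 1)).re +
      ((X (S.piecewise 1 0) (S.piecewise 1 0)).re + (X 1 1).re) ≤ 1 := by
    simpa [hX.trace_eq_one, Fintype.sum_prod_type, Finset.piecewise_same] using
      sum_re_diag_comp_le_re_trace hX.posSemidef (piecewise_const_injective (α := Fin 2) hi hj)
  rw [fidelity_ghz hX.posSemidef]
  linarith

lemma IsPPTState.not_ghzDistillable {S : Finset (Fin n)} {i j : Fin n} (hi : i ∈ S) (hj : j ∉ S)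
    {X : Op (Fin n → Fin 2)} (hX : IsPPTState S X) : ¬ GHZDistillable n X := by
  rintro ⟨Λ, hΛ, hlim⟩
  have hle : (1 : ℝ) ≤ 1 / 2 := le_of_tendsto' hlim fun k =>
    ((hΛ k).isPPTState (hX.copies k)).fidelity_ghz_le hi hj
  norm_num at hle

end GHZ

section Teleportation

lemma bell_apply (u v x y : Fin 2) :
    bell u v (x, y) = ((1 / √2 : ℝ) : ℂ) * pauli u v x y := by
  simp only [bell, Matrix.mulVec, dotProduct, Matrix.kroneckerMap_apply, Fintype.sum_prod_type,
    phiPlus, Matrix.one_apply]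
  simp [mul_comm]

lemma pauli_mul_conjTranspose (u v : Fin 2) : pauli u v * (pauli u v).conjTranspose = 1 := by
  ext i j
  fin_cases u <;> fin_cases v <;> fin_cases i <;> fin_cases j <;> simp [pauli, Matrix.mul_apply]

lemma ofReal_one_div_sqrt_two_mul_self :
    ((1 / √2 : ℝ) : ℂ) * ((1 / √2 : ℝ) : ℂ) = 1 / 2 := by
  rw [← Complex.ofReal_mul, div_mul_div_comm, Real.mul_self_sqrt zero_le_two]
  norm_num

lemma ketbra_phiPlus :
    ketbra phiPlus =
      (1 / 2 : ℂ) • ∑ i : Fin 2, ∑ j : Fin 2,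
        Matrix.single i j (1 : ℂ) ⊗ₖ Matrix.single i j (1 : ℂ) := by
  have hvec : phiPlus = ((1 / √2 : ℝ) : ℂ) • ∑ i : Fin 2, Pi.single (i, i) 1 := by
    ext ⟨s, t⟩
    fin_cases s <;> fin_cases t <;> simp [phiPlus]
  rw [hvec, ketbra_ofReal_smul, div_pow, Real.sq_sqrt zero_le_two]
  simp only [ketbra, Fin.sum_univ_two, star_add, Pi.star_single, star_one, Matrix.vecMulVec_add,
    Matrix.add_vecMulVec, ← Matrix.single_eq_single_vecMulVec_single,
    Matrix.single_kronecker_single, mul_one]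
  push_cast
  module

lemma teleport_kronecker_kronecker (X Y Z : Op (Fin 2)) :
    teleport (X ⊗ₖ (Y ⊗ₖ Z)) = (1 / 2 : ℂ) • ∑ o : Fin 2 × Fin 2,
      ((pauli o.1 o.2).conjTranspose * X * pauli o.1 o.2 * Y.transpose).trace •
        (pauli o.1 o.2 * Z * (pauli o.1 o.2).conjTranspose) := by
  ext k l
  simp only [teleport, krausMap, LinearMap.coe_mk, AddHom.coe_mk, Matrix.sum_apply,
    Matrix.smul_apply, Finset.smul_sum, ← ofReal_one_div_sqrt_two_mul_self, bell_apply]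
  refine Finset.sum_congr rfl fun o _ => ?_
  simp only [Matrix.mul_apply, Matrix.trace, Matrix.diag, Matrix.of_apply, Fintype.sum_prod_type,
    Matrix.kroneckerMap_apply, Matrix.conjTranspose_apply, Matrix.transpose_apply,
    Fin.sum_univ_two, star_mul', Complex.star_def, Complex.conj_ofReal, Complex.conj_conj,
    smul_eq_mul]
  ring

lemma teleport_kronecker_one (X : Op (Fin 2)) :
    teleport (X ⊗ₖ (1 : Op (Fin 2 × Fin 2))) = (2 * X.trace) • (1 : Op (Fin 2)) := by
  have htrace (o : Fin 2 × Fin 2) :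
      ((pauli o.1 o.2).conjTranspose * X * pauli o.1 o.2).trace = X.trace := by
    rw [Matrix.trace_mul_cycle, pauli_mul_conjTranspose, one_mul]
  rw [← Matrix.one_kronecker_one, teleport_kronecker_kronecker]
  simp only [Matrix.transpose_one, mul_one, htrace, pauli_mul_conjTranspose, Finset.sum_const,
    Finset.card_univ, Fintype.card_prod, Fintype.card_fin]
  module

lemma sum_trace_mul_single_transpose_smul {a : Type} [Fintype a] [DecidableEq a] (M P Q : Op a) :
    ∑ i, ∑ j, (M * (Matrix.single i j (1 : ℂ)).transpose).trace • (P * Matrix.single i j 1 * Q) =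
      P * M * Q := by
  have hM : M = ∑ i, ∑ j, M i j • Matrix.single i j (1 : ℂ) := by
    simpa only [Matrix.smul_single, smul_eq_mul, mul_one] using Matrix.matrix_eq_sum_single M
  conv_rhs => rw [hM]
  simp only [Matrix.mul_sum, Matrix.sum_mul, Matrix.transpose_single, Matrix.trace_mul_single,
    Matrix.mul_smul, Matrix.smul_mul, MulOpposite.op_one, one_smul]

lemma teleport_kronecker_ketbra_phiPlus (X : Op (Fin 2)) :
    teleport (X ⊗ₖ ketbra phiPlus) = X := by
  have hcorrect (o : Fin 2 × Fin 2) :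
      pauli o.1 o.2 * ((pauli o.1 o.2).conjTranspose * X * pauli o.1 o.2) *
        (pauli o.1 o.2).conjTranspose = X := by
    set P := pauli o.1 o.2
    calc _ = P * P.conjTranspose * X * (P * P.conjTranspose) := by simp only [Matrix.mul_assoc]
      _ = X := by rw [pauli_mul_conjTranspose, one_mul, mul_one]
  have hsum : X ⊗ₖ ketbra phiPlus = (1 / 2 : ℂ) • ∑ i : Fin 2, ∑ j : Fin 2,
      X ⊗ₖ (Matrix.single i j (1 : ℂ) ⊗ₖ Matrix.single i j (1 : ℂ)) := by
    rw [ketbra_phiPlus, Matrix.kronecker_smul]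
    simp only [Fin.sum_univ_two, Matrix.kronecker_add]
  rw [hsum]
  simp only [map_smul, map_sum, teleport_kronecker_kronecker, ← Finset.smul_sum]
  rw [Finset.sum_congr rfl fun i _ => Finset.sum_comm, Finset.sum_comm]
  simp only [sum_trace_mul_single_transpose_smul, hcorrect, Finset.sum_const, Finset.card_univ,
    Fintype.card_prod, Fintype.card_fin]
  module

lemma noisyTeleport_apply (p : ℝ) (X : Op (Fin 2)) :
    noisyTeleport p X = (p : ℂ) • X + ((1 - p) / 2 * X.trace) • (1 : Op (Fin 2)) := by
  change teleport (X ⊗ₖ isotropic p) = _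
  rw [isotropic, Matrix.kronecker_add, Matrix.kronecker_smul, Matrix.kronecker_smul, map_add,
    map_smul, map_smul, teleport_kronecker_ketbra_phiPlus, teleport_kronecker_one, smul_smul]
  push_cast
  module

lemma isTP_noisyTeleport (p : ℝ) : IsTP (noisyTeleport p) := by
  intro X
  rw [noisyTeleport_apply, Matrix.trace_add, Matrix.trace_smul, Matrix.trace_smul,
    Matrix.trace_one, Fintype.card_fin, smul_eq_mul, smul_eq_mul]
  push_cast
  ring

end Teleportation

section TeleportedGHZ

variable {p : ℝ} {n : ℕ}

/-- The probability that independent bit flips, each of probability `(1 - p) / 2`, turn the bit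
string `x` into `s`. This is the diagonal entry at `s` of the teleported basis state `|x⟩⟨x|`. -/
noncomputable def bitFlipProb (p : ℝ) (x s : Fin n → Fin 2) : ℝ :=
  ∏ i, if s i = x i then (1 + p) / 2 else (1 - p) / 2

lemma bitFlipProb_nonneg (hp : |p| ≤ 1) (x s : Fin n → Fin 2) : 0 ≤ bitFlipProb p x s :=
  Finset.prod_nonneg fun i _ => by
    obtain ⟨h₁, h₂⟩ := abs_le.mp hp
    split_ifs <;> linarith

lemma bitFlipProb_piecewise (S : Finset (Fin n)) {x y : Fin n → Fin 2} (hxy : ∀ i, y i ≠ x i) :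
    bitFlipProb p x (S.piecewise x y) =
      ((1 + p) / 2) ^ S.card * ((1 - p) / 2) ^ Sᶜ.card := by
  have hfactor (i : Fin n) :
      (if S.piecewise x y i = x i then (1 + p) / 2 else (1 - p) / 2) =
        if i ∈ S then (1 + p) / 2 else (1 - p) / 2 := by
    by_cases hi : i ∈ S <;> simp [hi, hxy i]
  simp only [bitFlipProb, hfactor, Finset.prod_ite, Finset.prod_const, Finset.filter_mem_eq_inter,
    Finset.univ_inter, ← Finset.mem_compl]

lemma bitFlipProb_add_bitFlipProb_piecewise (S : Finset (Fin n)) {x y : Fin n → Fin 2}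
    (hxy : ∀ i, x i ≠ y i) :
    bitFlipProb p x (S.piecewise x y) + bitFlipProb p y (S.piecewise x y) =
      ((1 + p) / 2) ^ S.card * ((1 - p) / 2) ^ Sᶜ.card +
        ((1 - p) / 2) ^ S.card * ((1 + p) / 2) ^ Sᶜ.card := by
  rw [bitFlipProb_piecewise S fun i => (hxy i).symm, ← Finset.piecewise_compl,
    bitFlipProb_piecewise Sᶜ hxy, compl_compl, mul_comm (((1 - p) / 2) ^ S.card)]

lemma tensorMap_noisyTeleport_single_self (p : ℝ) (x : Fin n → Fin 2) :
    tensorMap (fun _ => noisyTeleport p) (Matrix.single x x 1) =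
      Matrix.diagonal fun s => (bitFlipProb p x s : ℂ) := by
  have hlocal (a : Fin 2) : noisyTeleport p (Matrix.single a a 1) =
      Matrix.diagonal fun s => ((if s = a then (1 + p) / 2 else (1 - p) / 2 : ℝ) : ℂ) := by
    rw [noisyTeleport_apply, Matrix.trace_single_eq_same]
    ext s t
    simp only [Matrix.add_apply, Matrix.smul_apply, Matrix.single_apply, Matrix.one_apply,
      Matrix.diagonal_apply, smul_eq_mul, apply_ite Complex.ofReal]
    push_cast
    grind
  ext s t
  simp only [tensorMap_single, hlocal, Matrix.diagonal_apply, Fintype.prod_ite_zero,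
    ← funext_iff, bitFlipProb, Complex.ofReal_prod]

lemma tensorMap_noisyTeleport_single (p : ℝ) {x y : Fin n → Fin 2} (hxy : ∀ i, x i ≠ y i) :
    tensorMap (fun _ => noisyTeleport p) (Matrix.single x y 1) =
      ((p ^ n : ℝ) : ℂ) • Matrix.single x y 1 := by
  ext s t
  have hlocal (i : Fin n) : noisyTeleport p (Matrix.single (x i) (y i) 1) (s i) (t i) =
      if x i = s i ∧ y i = t i then (p : ℂ) else 0 := by
    simp [noisyTeleport_apply, Matrix.trace_single_eq_of_ne _ _ _ (hxy i), Matrix.single_apply]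
  simp only [tensorMap_single, hlocal, Fintype.prod_ite_zero, forall_and, ← funext_iff,
    Finset.prod_const, Finset.card_univ, Fintype.card_fin, Matrix.smul_apply, Matrix.single_apply]
  simp

lemma teleportedGHZ_eq (p : ℝ) (n : ℕ) :
    teleportedGHZ p n =
      Matrix.diagonal (fun s => (((bitFlipProb p 0 s + bitFlipProb p 1 s) / 2 : ℝ) : ℂ)) +
        ((p ^ n / 2 : ℝ) : ℂ) • (Matrix.single 0 1 1 + Matrix.single 1 0 1) := by
  have hdiag : Matrix.diagonal
        (fun s => (((bitFlipProb p 0 s + bitFlipProb p 1 s) / 2 : ℝ) : ℂ)) =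
      (1 / 2 : ℂ) • (Matrix.diagonal (fun s : Fin n → Fin 2 => (bitFlipProb p 0 s : ℂ)) +
        Matrix.diagonal fun s => (bitFlipProb p 1 s : ℂ)) := by
    rw [Matrix.diagonal_add, ← Matrix.diagonal_smul]
    congr 1
    ext s
    simp only [Pi.smul_apply, smul_eq_mul]
    push_cast
    ring
  rw [teleportedGHZ, ghz_eq, map_smul, map_add, map_add, map_add,
    tensorMap_noisyTeleport_single_self, tensorMap_noisyTeleport_single_self,
    tensorMap_noisyTeleport_single p (x := 0) (y := 1) fun _ => zero_ne_one,
    tensorMap_noisyTeleport_single p (x := 1) (y := 0) fun _ => one_ne_zero, hdiag]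
  push_cast
  module

lemma trace_ghz (hn : n ≠ 0) : (ghz n).trace = 1 := by
  have h01 : (0 : Fin n → Fin 2) ≠ 1 :=
    Function.ne_iff.mpr ⟨⟨0, Nat.pos_of_ne_zero hn⟩, zero_ne_one⟩
  rw [ghz_eq]
  simp only [Matrix.trace_smul, Matrix.trace_add, Matrix.trace_single_eq_same,
    Matrix.trace_single_eq_of_ne _ _ _ h01, Matrix.trace_single_eq_of_ne _ _ _ h01.symm]
  norm_num

lemma trace_teleportedGHZ (p : ℝ) (hn : n ≠ 0) : (teleportedGHZ p n).trace = 1 :=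
  (isTP_tensorMap (fun _ => isTP_noisyTeleport p) _).trans (trace_ghz hn)

lemma piecewise_ne_piecewise_swap {ι α : Type} [DecidableEq ι] [Nonempty ι] (S : Finset ι)
    {x y : ι → α} (hxy : ∀ i, x i ≠ y i) : S.piecewise x y ≠ S.piecewise y x := by
  inhabit ι
  refine Function.ne_iff.mpr ⟨default, ?_⟩
  by_cases h : default ∈ S <;> simp [h, hxy, (hxy _).symm]

lemma posSemidef_partialTranspose_teleportedGHZ (hp : |p| ≤ 1) (hn : n ≠ 0) (S : Finset (Fin n))
    (h : |p| ^ n ≤ ((1 + p) / 2) ^ S.card * ((1 - p) / 2) ^ Sᶜ.card +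
      ((1 - p) / 2) ^ S.card * ((1 + p) / 2) ^ Sᶜ.card) :
    (partialTranspose S (teleportedGHZ p n)).PosSemidef := by
  have : Nonempty (Fin n) := ⟨⟨0, Nat.pos_of_ne_zero hn⟩⟩
  have h01 (i : Fin n) : (0 : Fin n → Fin 2) i ≠ (1 : Fin n → Fin 2) i := zero_ne_one
  have h10 (i : Fin n) : (1 : Fin n → Fin 2) i ≠ (0 : Fin n → Fin 2) i := one_ne_zero
  rw [teleportedGHZ_eq, map_add, partialTranspose_diagonal, map_smul, map_add,
    partialTranspose_single, partialTranspose_single]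
  refine posSemidef_diagonal_add_single
    (fun s => by linarith [bitFlipProb_nonneg hp 0 s, bitFlipProb_nonneg hp 1 s])
    (piecewise_ne_piecewise_swap S h10) ?_ ?_ <;>
    rw [abs_div, abs_pow, abs_two]
  · rw [add_comm (bitFlipProb p 0 _), bitFlipProb_add_bitFlipProb_piecewise S h10]
    gcongr
  · rw [bitFlipProb_add_bitFlipProb_piecewise S h01]
    gcongr

lemma abs_pow_le_add_pow (hp : |p| ≤ 1) (n : ℕ) :
    |p| ^ n ≤ ((1 + p) / 2) ^ n + ((1 - p) / 2) ^ n := by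
  obtain ⟨h₁, h₂⟩ := abs_le.mp hp
  rcases abs_cases p with ⟨hp', _⟩ | ⟨hp', _⟩ <;> rw [hp']
  · have := pow_le_pow_left₀ (by linarith : 0 ≤ p) (by linarith : p ≤ (1 + p) / 2) n
    have : 0 ≤ ((1 - p) / 2) ^ n := pow_nonneg (by linarith) n
    linarith
  · have := pow_le_pow_left₀ (by linarith : 0 ≤ -p) (by linarith : -p ≤ (1 - p) / 2) n
    have : 0 ≤ ((1 + p) / 2) ^ n := pow_nonneg (by linarith) n
    linarith

lemma isPPTState_teleportedGHZ (hp : |p| ≤ 1) (hn : n ≠ 0) {S : Finset (Fin n)}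
    (h : |p| ^ n ≤ ((1 + p) / 2) ^ S.card * ((1 - p) / 2) ^ Sᶜ.card +
      ((1 - p) / 2) ^ S.card * ((1 + p) / 2) ^ Sᶜ.card) :
    IsPPTState S (teleportedGHZ p n) where
  posSemidef := by
    rw [← partialTranspose_empty (teleportedGHZ p n)]
    refine posSemidef_partialTranspose_teleportedGHZ hp hn ∅ ?_
    simpa [add_comm] using abs_pow_le_add_pow hp n
  posSemidef_partialTranspose := posSemidef_partialTranspose_teleportedGHZ hp hn S h
  trace_eq_one := trace_teleportedGHZ p hn

lemma eventually_abs_pow_le (hp : |p| < 1) :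
    ∀ᶠ n : ℕ in atTop, |p| ^ n ≤
      (1 + p) / 2 * ((1 - p) / 2) ^ (n - 1) + (1 - p) / 2 * ((1 + p) / 2) ^ (n - 1) := by
  obtain ⟨h₁, h₂⟩ := abs_lt.mp hp
  have hlarge : ∀ᶠ m : ℕ in atTop, |p| ^ m ≤ (1 - |p|) / 2 * ((1 + |p|) / 2) ^ m := by
    have h := (isLittleO_pow_pow_of_lt_left (abs_nonneg p) (by linarith : |p| < (1 + |p|) / 2)).def
      (by linarith : 0 < (1 - |p|) / 2)
    filter_upwards [h] with m hm
    rwa [Real.norm_of_nonneg (by positivity), Real.norm_of_nonneg (by positivity)] at hm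
  filter_upwards [(tendsto_sub_atTop_nat 1).eventually hlarge] with n hn
  refine ((pow_le_pow_of_le_one (abs_nonneg p) hp.le (n.sub_le 1)).trans hn).trans ?_
  have ha : 0 ≤ (1 + p) / 2 * ((1 - p) / 2) ^ (n - 1) :=
    mul_nonneg (by linarith) (pow_nonneg (by linarith) _)
  have hb : 0 ≤ (1 - p) / 2 * ((1 + p) / 2) ^ (n - 1) :=
    mul_nonneg (by linarith) (pow_nonneg (by linarith) _)
  rcases abs_choice p with h | h <;> rw [h]
  · linarith
  · rw [← sub_eq_add_neg, sub_neg_eq_add]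
    linarith

end TeleportedGHZ

end GHZNetwork

theorem theorem2_general (p : ℝ) (hp : |p| < 1) :
    ∃ n₀ : ℕ, ∀ n ≥ n₀, ¬ GHZNetwork.GHZDistillable n (GHZNetwork.teleportedGHZ p n) := by
  refine Filter.eventually_atTop.mp ?_
  filter_upwards [GHZNetwork.eventually_abs_pow_le hp, Filter.eventually_ge_atTop 2] with n hpow hn
  let i : Fin n := ⟨0, by omega⟩
  let j : Fin n := ⟨1, by omega⟩
  have hPPT : GHZNetwork.IsPPTState {i} (GHZNetwork.teleportedGHZ p n) :=
    GHZNetwork.isPPTState_teleportedGHZ hp.le (by omega) <| by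
      simpa [Finset.card_compl] using hpow
  exact hPPT.not_ghzDistillable (i := i) (j := j) (by simp) (by simp [i, j])

theorem theorem2 (p : ℝ) (hp0 : 0 ≤ p) (hp1 : p < 1) :
    ∃ n₀ : ℕ, ∀ n ≥ n₀, ¬ GHZNetwork.GHZDistillable n (GHZNetwork.teleportedGHZ p n) :=
  theorem2_general p (abs_lt.mpr ⟨by linarith, hp1⟩)
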